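/- Let $K$ be a compact Hausdorff space, $\mathrm{C}(K)$ the Banach lattice of continuous complex-valued functions on $K$, and let $\mathcal{S}\subset\mathscr{L}(\mathrm{C}(K))$ be a semigroup of Markov operators (positive operators $S$ with $S\mathbf{1}=\mathbf{1}$) which is right amenable for the strong operator topology, i.e. there is a positive functional $m\in \mathrm{C}_{\mathrm b}(\mathcal{S})'$ with $m(\mathbf{1})=1$ and $m(R_Sf)=m(f)$ for all $S\in\mathcal{S}$, $f\in \mathrm{C}_{\mathrm b}(\mathcal{S})$, where $R_Sf(T)=f(TS)$. An $\mathcal{S}$-ideal is a closed proper ideal $I\subset\mathrm{C}(K)$ with $SI\subset I$ for all $S\in\mathcal{S}$. Each $\mathcal{S}$-ideal is of the form $I_L=\{f\in\mathrm{C}(K) : f|_L=0\}$ for a unique closed set $L\subset K$, called its support. A regular Borel probability measure $\mu$ on $K$ is invariant if $\int Sf\,\mathrm{d}\mu=\int f\,\mathrm{d}\mu$ for all $S\in\mathcal{S}$, $f\in\mathrm{C}(K)$. In this case each $S\in\mathcal{S}$ induces a bounded operator $S_\mu$ on $\mathrm{L}^1(K,\mu)$, and $\mu$ is called ergodic if the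 common fixed space of all $S_\mu$, $S\in\mathcal{S}$, is one-dimensional. An $\mathcal{S}$-ideal $p$ is primitive if $p=I_\mu:=\{f : \int|f|\,\mathrm{d}\mu=0\}$ for some ergodic $\mu$. The $\mathcal{S}$-radical $\mathrm{rad}_{\mathcal{S}}(I)$ of $I\subset \mathrm{C}(K)$ is the intersection of all primitive $\mathcal{S}$-ideals containing $I$ (which is $\mathrm{C}(K)$ if there are none), and an $\mathcal{S}$-ideal $I$ is a radical $\mathcal{S}$-ideal if $I=\mathrm{rad}_{\mathcal{S}}(I)$. A net $(T_\alpha)_{\alpha\in A}$ in the closed convex hull of $\mathcal{S}$ with respect to the strong operator topology is a right ergodic operator net for $\mathcal{S}$ if $\lim_\alpha T_\alpha(\mathrm{Id}-S)=0$ in the strong operator topology for each $S\in\mathcal{S}$. **Theorem.** Let $L\subset K$ be the support of an $\mathcal{S}$-ideal and let $(T_\alpha)_{\alpha\in A}$ be any right ergodic operator net for $\mathcal{S}$. Then $$\mathrm{rad}_{\mathcal{S}}(I_L)=\Big\{f\in\mathrm{C}(K) : \lim_\alpha\langle (T_\alpha|f|)|_L,\mu\rangle=0\text{ for each }\mu\in\mathrm{C}(L)'\Big\}$$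 $$=\Big\{f\in\mathrm{C}(K) : \lim_\alpha (T_\alpha|f|)|_L=0\text{ in the norm of }\mathrm{C}(L)\Big\}.$$ In particular, $I_L$ is a radical $\mathcal{S}$-ideal if and only if every $f\in\mathrm{C}(K)$ with $\lim_\alpha (T_\alpha|f|)|_L=0$ in the norm of $\mathrm{C}(L)$ vanishes on $L$. -/

import Mathlib

open MeasureTheory Filter Topology

open scoped ComplexOrder BoundedContinuousFunction

namespace MarkovRadical

/-- Bounded linear operators on the Banach lattice of complex-valued continuous functions on `K`. -/
abbrev Op (K : Type*) [TopologicalSpace K] [CompactSpace K] : Type _ :=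
  C(K, ℂ) →L[ℂ] C(K, ℂ)

/-- The modulus `|f|` of a continuous function, again as an element of `C(K)`. -/
noncomputable def modulus {K : Type*} [TopologicalSpace K] (f : C(K, ℂ)) : C(K, ℂ) where
  toFun x := (‖f x‖ : ℂ)
  continuous_toFun := by fun_prop

/-- Markov operators: positive operators that fix the constant function `1`. For complex numbers,
`0 ≤ z` means that `z` is a nonnegative real number. -/
structure IsMarkov {K : Type*} [TopologicalSpace K] [CompactSpace K] (T : Op K) : Prop where
  positive : ∀ f : C(K, ℂ), (∀ x, 0 ≤ f x) → ∀ x, 0 ≤ T f x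
  map_one : T 1 = 1

section Amenability

variable {K : Type*} [TopologicalSpace K] [CompactSpace K]

/-- An operator, viewed as an element of the space of operators with the strong operator topology,
i.e. the topology of pointwise convergence on `C(K)` with respect to the norm of `C(K)`. -/
noncomputable def toSOT (T : Op K) : C(K, ℂ) →Lₚₜ[ℂ] C(K, ℂ) :=
  ContinuousLinearMap.toPointwiseConvergenceCLM ℂ (RingHom.id ℂ) C(K, ℂ) C(K, ℂ) T

/-- A semigroup of operators, as a topological semigroup with the strong operator topology. -/
def WithSOT (𝒮 : Subsemigroup (Op K)) : Type _ := 𝒮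

noncomputable instance (𝒮 : Subsemigroup (Op K)) : Semigroup (WithSOT 𝒮) :=
  inferInstanceAs (Semigroup 𝒮)

noncomputable instance (𝒮 : Subsemigroup (Op K)) : TopologicalSpace (WithSOT 𝒮) :=
  TopologicalSpace.induced (fun S : 𝒮 => toSOT (S : Op K)) inferInstance

theorem continuous_mul_right_sot (𝒮 : Subsemigroup (Op K)) (S : WithSOT 𝒮) :
    Continuous fun T : WithSOT 𝒮 => T * S := by
  refine continuous_induced_rng.2 ?_
  refine PointwiseConvergenceCLM.continuous_of_continuous_eval fun f => ?_
  exact ((PointwiseConvergenceCLM.evalCLM (RingHom.id ℂ) C(K, ℂ)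
    ((show 𝒮 from S : Op K) f)).continuous).comp continuous_induced_dom

/-- The right translation operator `(R_S f)(T) = f(T S)` on the space `C_b(𝒮)`. -/
noncomputable def rightTranslate (𝒮 : Subsemigroup (Op K)) (S : WithSOT 𝒮)
    (f : WithSOT 𝒮 →ᵇ ℂ) : WithSOT 𝒮 →ᵇ ℂ :=
  f.compContinuous ⟨fun T => T * S, continuous_mul_right_sot 𝒮 S⟩

/-- Right amenability: there is a right invariant mean on `C_b(𝒮)`, where `𝒮` carries the strong
operator topology. -/
def IsRightAmenable (𝒮 : Subsemigroup (Op K)) : Prop :=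
  ∃ m : (WithSOT 𝒮 →ᵇ ℂ) →L[ℂ] ℂ,
    (∀ f, (∀ T, 0 ≤ f T) → 0 ≤ m f) ∧ m 1 = 1 ∧ ∀ S f, m (rightTranslate 𝒮 S f) = m f

end Amenability

section Ideals

variable {K : Type*} [TopologicalSpace K]

/-- `𝒮`-ideals: closed proper `𝒮`-invariant ideals of `C(K)`. -/
structure IsSIdeal [CompactSpace K] (𝒮 : Subsemigroup (Op K)) (I : Ideal C(K, ℂ)) : Prop where
  isClosed : IsClosed (I : Set C(K, ℂ))
  ne_top : I ≠ ⊤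
  invariant : ∀ S ∈ 𝒮, ∀ f ∈ I, S f ∈ I

/-- The ideal `I_L` of all continuous functions that vanish on `L`. -/
noncomputable def vanishingIdeal (L : Set K) : Ideal C(K, ℂ) := ContinuousMap.idealOfSet ℂ Lᶜ

theorem mem_vanishingIdeal {L : Set K} {f : C(K, ℂ)} :
    f ∈ vanishingIdeal L ↔ ∀ x ∈ L, f x = 0 := by
  simp [vanishingIdeal, ContinuousMap.mem_idealOfSet]

instance [CompactSpace K] (L : TopologicalSpace.Closeds K) : CompactSpace (L : Set K) :=
  isCompact_iff_compactSpace.1 L.isClosed.isCompact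

end Ideals

section Measures

variable {K : Type*} [TopologicalSpace K] [CompactSpace K] [MeasurableSpace K] [BorelSpace K]

/-- `μ` is an `𝒮`-invariant regular Borel probability measure. -/
structure IsInvariantProb (𝒮 : Subsemigroup (Op K)) (μ : Measure K) : Prop where
  isProbabilityMeasure : IsProbabilityMeasure μ
  regular : μ.Regular
  invariant : ∀ S ∈ 𝒮, ∀ f : C(K, ℂ), ∫ x, S f x ∂μ = ∫ x, f x ∂μ

/-- The operator `S_μ` on `L¹(K, μ)` induced by `S`: the continuous extension of the map that
sends the class of `f ∈ C(K)` to the class of `S f`. -/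
noncomputable def inducedL1 (μ : Measure K) [IsFiniteMeasure μ] (S : Op K) :
    Lp ℂ 1 μ →L[ℂ] Lp ℂ 1 μ :=
  ((ContinuousMap.toLp 1 μ ℂ : C(K, ℂ) →L[ℂ] Lp ℂ 1 μ).comp S).toLinearMap.extendOfNorm
    (ContinuousMap.toLp 1 μ ℂ : C(K, ℂ) →L[ℂ] Lp ℂ 1 μ).toLinearMap

/-- The fixed space of the semigroup `{S_μ | S ∈ 𝒮}` in `L¹(K, μ)`. -/
noncomputable def fixL1 (𝒮 : Subsemigroup (Op K)) (μ : Measure K) [IsFiniteMeasure μ] :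
    Submodule ℂ (Lp ℂ 1 μ) :=
  ⨅ S ∈ 𝒮, LinearMap.eqLocus (inducedL1 μ S).toLinearMap LinearMap.id

/-- Ergodic measures: invariant probability measures for which the fixed space in `L¹(K, μ)` is
one-dimensional. -/
def IsErgodic (𝒮 : Subsemigroup (Op K)) (μ : Measure K) : Prop :=
  ∃ h : IsInvariantProb 𝒮 μ,
    haveI := h.isProbabilityMeasure
    Module.finrank ℂ (fixL1 𝒮 μ) = 1

/-- The absolute kernel `I_μ` of a measure. -/
def absKernel (μ : Measure K) : Set C(K, ℂ) := {f | ∫ x, ‖f x‖ ∂μ = 0}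

/-- The primitive spectrum: all `𝒮`-ideals that are the absolute kernel of an ergodic measure. -/
def primSpectrum (𝒮 : Subsemigroup (Op K)) : Set (Ideal C(K, ℂ)) :=
  {p | IsSIdeal 𝒮 p ∧ ∃ μ : Measure K, IsErgodic 𝒮 μ ∧ (p : Set C(K, ℂ)) = absKernel μ}

/-- The hull of a subset of `C(K)`: all primitive ideals that contain it. -/
def hull (𝒮 : Subsemigroup (Op K)) (I : Set C(K, ℂ)) : Set (Ideal C(K, ℂ)) :=
  {p | p ∈ primSpectrum 𝒮 ∧ I ⊆ p}

/-- The `𝒮`-radical of a subset of `C(K)`: the intersection of all primitive ideals that contain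
it (all of `C(K)` if there are none). -/
def rad (𝒮 : Subsemigroup (Op K)) (I : Set C(K, ℂ)) : Set C(K, ℂ) :=
  ⋂ p ∈ hull 𝒮 I, (p : Set C(K, ℂ))

/-- Radical `𝒮`-ideals: `𝒮`-ideals that coincide with their `𝒮`-radical. -/
def IsRadicalSIdeal (𝒮 : Subsemigroup (Op K)) (I : Ideal C(K, ℂ)) : Prop :=
  IsSIdeal 𝒮 I ∧ (I : Set C(K, ℂ)) = rad 𝒮 I

end Measures

section Nets

variable {K : Type*} [TopologicalSpace K] [CompactSpace K]

/-- The closed convex hull of `𝒮` with respect to the strong operator topology. -/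
def closedConvexHullSOT (𝒮 : Subsemigroup (Op K)) : Set (Op K) :=
  toSOT ⁻¹' closure (toSOT '' convexHull ℝ (𝒮 : Set (Op K)))

/-- Right ergodic operator nets for `𝒮`: nets in the closed convex hull of `𝒮` such that
`T_α (Id - S)` tends to `0` in the strong operator topology for each `S ∈ 𝒮`. -/
structure IsRightErgodicNet (𝒮 : Subsemigroup (Op K)) {A : Type*} [Preorder A]
    (T : A → Op K) : Prop where
  mem_hull : ∀ α, T α ∈ closedConvexHullSOT 𝒮
  tendsto : ∀ S ∈ 𝒮, ∀ f : C(K, ℂ), Tendsto (fun α => T α (f - S f)) atTop (𝓝 0)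

end Nets

section InducedOperator

variable {K : Type*} [TopologicalSpace K] [CompactSpace K]

/-- Markov operators satisfy `|S f| ≤ S |f|`. -/
theorem IsMarkov.norm_apply_le {S : Op K} (hS : IsMarkov S) (f : C(K, ℂ)) (x : K) :
    ‖S f x‖ ≤ (S (modulus f) x).re := by
  let re' : C(K, ℂ) → C(K, ℂ) := fun g => ⟨fun y => ((g y).re : ℂ), by fun_prop⟩
  let im' : C(K, ℂ) → C(K, ℂ) := fun g => ⟨fun y => ((g y).im : ℂ), by fun_prop⟩
  have hreal : ∀ g : C(K, ℂ), (∀ y, (g y).im = 0) → (S g x).im = 0 := by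
    intro g hg
    have h1 : 0 ≤ S (((‖g‖ : ℂ)) • (1 : C(K, ℂ)) - g) x := by
      refine hS.positive _ (fun y => ?_) x
      have h2 := (Complex.abs_re_le_norm (g y)).trans (g.norm_coe_le_norm y)
      rw [Complex.nonneg_iff]
      constructor
      · simp
        exact (le_abs_self _).trans h2
      · simp [hg]
    rw [map_sub, map_smul, hS.map_one] at h1
    have := (Complex.nonneg_iff.1 h1).2
    simpa using this
  have key : ∀ g : C(K, ℂ), modulus g = modulus f → (S g x).re ≤ (S (modulus f) x).re := by
    intro g hg
    have hdec : g = re' g + Complex.I • im' g := by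
      ext y
      simp only [re', im', ContinuousMap.add_apply, ContinuousMap.smul_apply,
        ContinuousMap.coe_mk, smul_eq_mul]
      rw [mul_comm, Complex.re_add_im]
    have h3 : (S g x).re = (S (re' g) x).re := by
      conv_lhs => rw [hdec, map_add, map_smul]
      have := hreal (im' g) (fun y => by simp [im'])
      simp [this]
    have h4 : 0 ≤ S (modulus g - re' g) x := by
      refine hS.positive _ (fun y => ?_) x
      rw [Complex.nonneg_iff]
      constructor
      · simpa [modulus, re'] using (le_abs_self _).trans (Complex.abs_re_le_norm (g y))
      · simp [modulus, re']
    have h5 := (Complex.nonneg_iff.1 h4).1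
    rw [map_sub, hg] at h5
    simp only [ContinuousMap.sub_apply, Complex.sub_re] at h5
    linarith
  by_cases h0 : S f x = 0
  · rw [h0, norm_zero]
    exact (Complex.nonneg_iff.1 (hS.positive (modulus f) (fun y => by simp [modulus]) x)).1
  · set c : ℂ := (‖S f x‖ : ℂ) / S f x with hc
    have hcn : ‖c‖ = 1 := by
      rw [hc, norm_div, Complex.norm_real, norm_norm, div_self (norm_ne_zero_iff.2 h0)]
    have h6 := key (c • f) (by ext y; simp [modulus, hcn])
    rw [map_smul, ContinuousMap.smul_apply, smul_eq_mul, hc, div_mul_cancel₀ _ h0,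
      Complex.ofReal_re] at h6
    exact h6

variable [MeasurableSpace K] [BorelSpace K]

/-- For an invariant measure, a Markov operator in `𝒮` is a contraction for the `L¹`-norm. -/
theorem integral_norm_apply_le {𝒮 : Subsemigroup (Op K)} (h𝒮 : ∀ S ∈ 𝒮, IsMarkov S)
    {μ : Measure K} (hμ : IsInvariantProb 𝒮 μ) {S : Op K} (hS : S ∈ 𝒮) (f : C(K, ℂ)) :
    ∫ x, ‖S f x‖ ∂μ ≤ ∫ x, ‖f x‖ ∂μ := by
  have := hμ.isProbabilityMeasure
  have hint : ∀ g : C(K, ℂ), Integrable (fun x => g x) μ := fun g =>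
    g.continuous.integrable_of_hasCompactSupport (HasCompactSupport.of_compactSpace _)
  have h1 : ∫ x, ‖S f x‖ ∂μ ≤ ∫ x, (S (modulus f) x).re ∂μ :=
    integral_mono (hint (S f)).norm (hint (S (modulus f))).re
      (fun x => (h𝒮 S hS).norm_apply_le f x)
  have h2 : ∫ x, (S (modulus f) x).re ∂μ = (∫ x, S (modulus f) x ∂μ).re :=
    integral_re (hint (S (modulus f)))
  have h3 : ∫ x, modulus f x ∂μ = ((∫ x, ‖f x‖ ∂μ : ℝ) : ℂ) :=
    integral_ofReal
  rw [h2, hμ.invariant S hS, h3, Complex.ofReal_re] at h1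
  exact h1

theorem norm_toLp_one (μ : Measure K) [IsFiniteMeasure μ] (f : C(K, ℂ)) :
    ‖(ContinuousMap.toLp 1 μ ℂ f : Lp ℂ 1 μ)‖ = ∫ x, ‖f x‖ ∂μ := by
  rw [L1.norm_eq_integral_norm]
  refine integral_congr_ae ?_
  filter_upwards [ContinuousMap.coeFn_toLp (p := 1) (𝕜 := ℂ) μ f] with x hx
  rw [hx]

/-- For an invariant measure, `inducedL1 μ S` is indeed an extension of `S`. -/
theorem inducedL1_toLp [T2Space K] {𝒮 : Subsemigroup (Op K)} (h𝒮 : ∀ S ∈ 𝒮, IsMarkov S) {μ : Measure K}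
    [IsProbabilityMeasure μ] (hμ : IsInvariantProb 𝒮 μ) {S : Op K} (hS : S ∈ 𝒮) (f : C(K, ℂ)) :
    inducedL1 μ S (ContinuousMap.toLp 1 μ ℂ f) = ContinuousMap.toLp 1 μ ℂ (S f) := by
  have := hμ.regular
  have hd : DenseRange (ContinuousMap.toLp 1 μ ℂ : C(K, ℂ) →L[ℂ] Lp ℂ 1 μ).toLinearMap :=
    ContinuousMap.toLp_denseRange ℂ μ ℂ ENNReal.one_ne_top
  refine LinearMap.extendOfNorm_eq hd ⟨1, fun g => ?_⟩ f
  have h := integral_norm_apply_le h𝒮 hμ hS g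
  rw [← norm_toLp_one, ← norm_toLp_one] at h
  rw [one_mul]
  exact h

end InducedOperator

end MarkovRadical

/-! Everything runs through the set of `𝒮`-invariant states of `C(K)` that vanish on `I_L`, a
compact convex set in the topology of pointwise convergence on `C(K)`.

Its extreme points are ergodic measures. The modulus maps the fixed space in `L¹(μ)` to itself, and
the set where a fixed vector is nonzero is invariant for `μ` (`setIntegral_support_apply`). If `μ`
is extreme, an invariant set is null or conull, since otherwise `μ` is a proper convex combination
of its two conditional measures. Level sets of fixed vectors are such sets, so fixed vectors are
constant (`isErgodic_of_mem_extremePoints`). The kernel `I_μ` is then a primitive ideal containing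
`I_L`. Hence for `f` in the radical all extreme states annihilate `|f|`, and by Krein–Milman so do
all invariant states vanishing on `I_L`.

This forces uniform convergence on `L`. If `T_α|f|` stayed away from zero at points `x_α` of `L`, a
limit point of the states `g ↦ (T_α g)(x_α)` would be invariant by right ergodicity, would vanish on
`I_L` by invariance of the ideal, and would not annihilate `|f|`
(`tendsto_norm_restrict_of_invariantStates`).

Norm convergence trivially implies weak convergence. For the way back, an ergodic `μ` with `I_L ⊆
I_μ` lives on `L` and defines a functional on `C(L)`; since `∫ T_α|f| dμ = ∫ |f| dμ` for all `α`,
weak convergence to zero gives `f ∈ I_μ` (`mem_rad_of_tendsto`). -/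

namespace MarkovRadical

/-! ### States on `C(K)`, Riesz representation, and Krein–Milman for invariant states. -/

section States

variable {K : Type*} [TopologicalSpace K]

/-- States on `C(K)`: positive linear functionals that map `1` to `1`. -/
structure IsState (Λ : C(K, ℂ) → ℂ) : Prop where
  add : ∀ f g, Λ (f + g) = Λ f + Λ g
  smul : ∀ (c : ℂ) f, Λ (c • f) = c * Λ f
  nonneg : ∀ f : C(K, ℂ), (∀ x, 0 ≤ f x) → 0 ≤ Λ f
  one : Λ 1 = 1

/-- The linear map underlying a state. -/
def IsState.toLinearMap {Λ : C(K, ℂ) → ℂ} (h : IsState Λ) : C(K, ℂ) →ₗ[ℂ] ℂ where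
  toFun := Λ
  map_add' := h.add
  map_smul' := h.smul

/-- Real-valued continuous functions as elements of the complex space `C(K)`. -/
noncomputable def ofRealC (g : C(K, ℝ)) : C(K, ℂ) := ⟨fun x => (g x : ℂ), by fun_prop⟩

@[simp]
theorem ofRealC_apply (g : C(K, ℝ)) (x : K) : ofRealC g x = (g x : ℂ) := rfl

variable [CompactSpace K]

/-- Linear functionals on `C(K)` are determined by their values on nonnegative functions. -/
theorem linearMap_ext_of_nonneg {Λ₁ Λ₂ : C(K, ℂ) →ₗ[ℂ] ℂ}
    (h : ∀ f : C(K, ℂ), (∀ x, 0 ≤ f x) → Λ₁ f = Λ₂ f) : Λ₁ = Λ₂ := by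
  have hreal : ∀ g : C(K, ℝ), Λ₁ (ofRealC g) = Λ₂ (ofRealC g) := by
    intro g
    have hg : ofRealC g = ((ofRealC g) + ((‖g‖ : ℝ) : ℂ) • 1) - ((‖g‖ : ℝ) : ℂ) • 1 := by simp
    rw [hg, map_sub, map_sub, h, h]
    · intro x
      simp [Complex.zero_le_real]
    · intro x
      have h1 := neg_le_of_abs_le ((Real.norm_eq_abs _).symm.le.trans (g.norm_coe_le_norm x))
      have h2 : (0 : ℝ) ≤ g x + ‖g‖ := by linarith
      simpa using Complex.zero_le_real.2 h2
  ext f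
  have hf : f = ofRealC ⟨fun x => (f x).re, by fun_prop⟩ +
      Complex.I • ofRealC ⟨fun x => (f x).im, by fun_prop⟩ := by
    ext x
    simp only [ContinuousMap.add_apply, ContinuousMap.smul_apply, ofRealC_apply,
      ContinuousMap.coe_mk, smul_eq_mul]
    rw [mul_comm, Complex.re_add_im]
  rw [hf, map_add, map_add, map_smul, map_smul, hreal, hreal]

theorem integrable_continuousMap [MeasurableSpace K] [BorelSpace K] (μ : Measure K)
    [IsFiniteMeasure μ] (f : C(K, ℂ)) : Integrable (fun x => f x) μ :=
  f.continuous.integrable_of_hasCompactSupport (HasCompactSupport.of_compactSpace _)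

theorem isState_integral [MeasurableSpace K] [BorelSpace K] (μ : Measure K)
    [IsProbabilityMeasure μ] : IsState fun f : C(K, ℂ) => ∫ x, f x ∂μ where
  add f g := integral_add (integrable_continuousMap μ f) (integrable_continuousMap μ g)
  smul c f := by simp [integral_const_mul]
  nonneg f hf := integral_nonneg hf
  one := by simp

/-- The **Riesz representation theorem** for states on the complex space `C(K)`. -/
theorem IsState.exists_measure [T2Space K] [MeasurableSpace K] [BorelSpace K]
    {Λ : C(K, ℂ) → ℂ} (h : IsState Λ) :
    ∃ μ : Measure K, IsProbabilityMeasure μ ∧ μ.Regular ∧ ∀ f : C(K, ℂ), Λ f = ∫ x, f x ∂μ := by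
  let lin : CompactlySupportedContinuousMap K ℝ →ₗ[ℝ] ℝ :=
    { toFun := fun g => (Λ (ofRealC g.toContinuousMap)).re
      map_add' := fun f g => by
        have : ofRealC (f + g).toContinuousMap
            = ofRealC f.toContinuousMap + ofRealC g.toContinuousMap := by
          ext x; simp
        rw [this, h.add, Complex.add_re]
      map_smul' := fun c f => by
        have : ofRealC (c • f).toContinuousMap = (c : ℂ) • ofRealC f.toContinuousMap := by
          ext x; simp
        rw [this, h.smul, Complex.re_ofReal_mul]; rfl }
  let P : CompactlySupportedContinuousMap K ℝ →ₚ[ℝ] ℝ := PositiveLinearMap.mk₀ lin fun g hg =>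
    (Complex.nonneg_iff.1 (h.nonneg (ofRealC g.toContinuousMap)
      fun x => Complex.zero_le_real.2 (hg x))).1
  have hP : ∀ g : C(K, ℝ), ∫ x, g x ∂(RealRMK.rieszMeasure P) = (Λ (ofRealC g)).re := fun g =>
    RealRMK.integral_rieszMeasure P
      (CompactlySupportedContinuousMap.continuousMapEquiv g)
  have hreg : (RealRMK.rieszMeasure P).Regular := inferInstance
  have hfin : IsFiniteMeasure (RealRMK.rieszMeasure P) :=
    ⟨isCompact_univ.measure_lt_top⟩
  have hone : ofRealC (1 : C(K, ℝ)) = 1 := by ext x; simp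
  have hprob : IsProbabilityMeasure (RealRMK.rieszMeasure P) := by
    have h1 := hP 1
    rw [hone, h.one] at h1
    simp only [ContinuousMap.one_apply, integral_const, smul_eq_mul, mul_one,
      Complex.one_re, measureReal_def] at h1
    exact ⟨(ENNReal.toReal_eq_one_iff _).1 h1⟩
  refine ⟨_, hprob, hreg, fun f => ?_⟩
  have hext : h.toLinearMap = (isState_integral (RealRMK.rieszMeasure P)).toLinearMap := by
    refine linearMap_ext_of_nonneg fun f hf => ?_
    change Λ f = ∫ x, f x ∂_
    let g : C(K, ℝ) := ⟨fun x => (f x).re, by fun_prop⟩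
    have hfg : f = ofRealC g := by
      ext x
      exact (Complex.eq_re_of_ofReal_le (hf x))
    have hΛ : Λ f = ((Λ f).re : ℂ) := Complex.eq_re_of_ofReal_le (h.nonneg f hf)
    rw [hΛ, hfg, ← hP]
    exact integral_ofReal.symm
  exact LinearMap.congr_fun hext f

theorem IsState.norm_le [T2Space K] {Λ : C(K, ℂ) → ℂ} (h : IsState Λ) (f : C(K, ℂ)) :
    ‖Λ f‖ ≤ ‖f‖ := by
  borelize K
  obtain ⟨μ, _, _, hμ⟩ := h.exists_measure
  rw [hμ]
  simpa using norm_integral_le_of_norm_le_const (μ := μ) (ae_of_all _ f.norm_coe_le_norm)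

/-- The `𝒮`-invariant states that vanish on `I_L`. -/
def invariantStates (𝒮 : Subsemigroup (Op K)) (L : Set K) : Set (C(K, ℂ) → ℂ) :=
  {Λ | IsState Λ ∧ (∀ S ∈ 𝒮, ∀ f, Λ (S f) = Λ f) ∧ ∀ f, (∀ x ∈ L, f x = 0) → Λ f = 0}

omit [CompactSpace K] in
theorem isClosed_setOf_isState : IsClosed {Λ : C(K, ℂ) → ℂ | IsState Λ} := by
  have : {Λ : C(K, ℂ) → ℂ | IsState Λ} =
      {Λ | ∀ f g, Λ (f + g) = Λ f + Λ g} ∩ {Λ | ∀ (c : ℂ) f, Λ (c • f) = c * Λ f} ∩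
        {Λ | ∀ f : C(K, ℂ), (∀ x, 0 ≤ f x) → Λ f ∈ Set.Ici 0} ∩ {Λ | Λ 1 = 1} := by
    ext Λ
    exact ⟨fun h => ⟨⟨⟨h.add, h.smul⟩, h.nonneg⟩, h.one⟩, fun h => ⟨h.1.1.1, h.1.1.2, h.1.2, h.2⟩⟩
  rw [this]
  refine IsClosed.inter (IsClosed.inter (IsClosed.inter ?_ ?_) ?_) ?_
  · simp only [Set.ofPred_forall]
    exact isClosed_iInter fun f => isClosed_iInter fun g => isClosed_eq (by fun_prop) (by fun_prop)
  · simp only [Set.ofPred_forall]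
    exact isClosed_iInter fun f => isClosed_iInter fun g => isClosed_eq (by fun_prop) (by fun_prop)
  · simp only [Set.ofPred_forall]
    refine isClosed_iInter fun f => isClosed_iInter fun _ => ?_
    exact isClosed_Ici.preimage (continuous_apply f)
  · exact isClosed_eq (by fun_prop) (by fun_prop)

/-- Banach–Alaoglu via Tychonoff: states have norm at most one, so they form a closed subset of a
product of discs of radius `‖f‖`. -/
theorem isCompact_setOf_isState [T2Space K] : IsCompact {Λ : C(K, ℂ) → ℂ | IsState Λ} := by
  refine (isCompact_univ_pi fun f : C(K, ℂ) =>
    isCompact_closedBall (0 : ℂ) ‖f‖).of_isClosed_subset isClosed_setOf_isState fun Λ h f _ => ?_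
  simpa using IsState.norm_le h f

theorem isCompact_invariantStates [T2Space K] (𝒮 : Subsemigroup (Op K)) (L : Set K) :
    IsCompact (invariantStates 𝒮 L) := by
  refine isCompact_setOf_isState.of_isClosed_subset ?_ fun Λ h => h.1
  refine isClosed_setOf_isState.inter (IsClosed.inter ?_ ?_)
  · change IsClosed {Λ : C(K, ℂ) → ℂ | ∀ S ∈ 𝒮, ∀ f, Λ (S f) = Λ f}
    simp only [Set.ofPred_forall]
    exact isClosed_iInter fun S => isClosed_iInter fun _ => isClosed_iInter fun f =>
      isClosed_eq (by fun_prop) (by fun_prop)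
  · change IsClosed {Λ : C(K, ℂ) → ℂ | ∀ f : C(K, ℂ), (∀ x ∈ L, f x = 0) → Λ f = 0}
    simp only [Set.ofPred_forall]
    exact isClosed_iInter fun f => isClosed_iInter fun _ =>
      isClosed_eq (by fun_prop) (by fun_prop)

theorem convex_invariantStates (𝒮 : Subsemigroup (Op K)) (L : Set K) :
    Convex ℝ (invariantStates 𝒮 L) := by
  rintro Λ₁ ⟨h₁, i₁, v₁⟩ Λ₂ ⟨h₂, i₂, v₂⟩ a b ha hb hab
  refine ⟨⟨fun f g => ?_, fun c f => ?_, fun f hf => ?_, ?_⟩, fun S hS f => ?_, fun f hf => ?_⟩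
  · simp only [Pi.add_apply, Pi.smul_apply, h₁.add, h₂.add, smul_add]
    ring
  · simp only [Pi.add_apply, Pi.smul_apply, h₁.smul, h₂.smul, Complex.real_smul]
    ring
  · simp only [Pi.add_apply, Pi.smul_apply, Complex.real_smul]
    exact add_nonneg (mul_nonneg (Complex.zero_le_real.2 ha) (h₁.nonneg f hf))
      (mul_nonneg (Complex.zero_le_real.2 hb) (h₂.nonneg f hf))
  · simp only [Pi.add_apply, Pi.smul_apply, h₁.one, h₂.one, Complex.real_smul, mul_one]
    exact_mod_cast hab
  · simp only [Pi.add_apply, Pi.smul_apply, i₁ S hS, i₂ S hS]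
  · simp only [Pi.add_apply, Pi.smul_apply, v₁ f hf, v₂ f hf, smul_zero, add_zero]

/-- A function that is annihilated by the extreme invariant states is annihilated by all
invariant states. -/
theorem eq_zero_of_extremePoints [T2Space K] {𝒮 : Subsemigroup (Op K)} {L : Set K} {f : C(K, ℂ)}
    (h : ∀ Λ ∈ (invariantStates 𝒮 L).extremePoints ℝ, Λ f = 0) {Λ : C(K, ℂ) → ℂ}
    (hΛ : Λ ∈ invariantStates 𝒮 L) : Λ f = 0 := by
  -- Krein–Milman; annihilating `f` is a closed convex condition on the state.
  rw [← closure_convexHull_extremePoints (isCompact_invariantStates 𝒮 L)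
    (convex_invariantStates 𝒮 L)] at hΛ
  have hc : IsClosed {Λ : C(K, ℂ) → ℂ | Λ f = 0} := isClosed_eq (by fun_prop) (by fun_prop)
  have hconv : Convex ℝ {Λ : C(K, ℂ) → ℂ | Λ f = 0} := by
    intro Λ₁ h₁ Λ₂ h₂ a b _ _ _
    simp_all
  exact closure_minimal (convexHull_min h hconv) hc hΛ

end States

/-! ### The fixed space in `L¹(μ)` and the invariance of supports of fixed vectors. -/

section FixedSpace

variable {K : Type*} [TopologicalSpace K] [CompactSpace K] [MeasurableSpace K] [BorelSpace K]

theorem lipschitzWith_norm_ofReal : LipschitzWith 1 fun z : ℂ => ((‖z‖ : ℝ) : ℂ) :=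
  LipschitzWith.of_dist_le_mul fun x y => by
    rw [Complex.dist_of_im_eq (by simp), NNReal.coe_one, one_mul, dist_eq_norm x y]
    simpa using dist_norm_norm_le x y

/-- The modulus of an element of `L¹`. -/
noncomputable def modL1 {μ : Measure K} (u : Lp ℂ 1 μ) : Lp ℂ 1 μ :=
  lipschitzWith_norm_ofReal.compLp (by simp) u

omit [TopologicalSpace K] [CompactSpace K] [BorelSpace K] in
theorem coeFn_modL1 {μ : Measure K} (u : Lp ℂ 1 μ) :
    ⇑(modL1 u) =ᵐ[μ] fun x => ((‖u x‖ : ℝ) : ℂ) :=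
  lipschitzWith_norm_ofReal.coeFn_compLp (by simp) u

omit [TopologicalSpace K] [CompactSpace K] [BorelSpace K] in
theorem continuous_modL1 {μ : Measure K} : Continuous (modL1 : Lp ℂ 1 μ → Lp ℂ 1 μ) :=
  lipschitzWith_norm_ofReal.continuous_compLp (by simp)

theorem modL1_toLp (μ : Measure K) [IsFiniteMeasure μ] (f : C(K, ℂ)) :
    modL1 (ContinuousMap.toLp 1 μ ℂ f) = ContinuousMap.toLp 1 μ ℂ (modulus f) := by
  refine Lp.ext ?_
  filter_upwards [coeFn_modL1 (ContinuousMap.toLp 1 μ ℂ f),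
    ContinuousMap.coeFn_toLp (p := 1) (𝕜 := ℂ) μ f,
    ContinuousMap.coeFn_toLp (p := 1) (𝕜 := ℂ) μ (modulus f)] with x h1 h2 h3
  rw [h1, h2, h3]
  rfl

variable [T2Space K] {𝒮 : Subsemigroup (Op K)} (h𝒮 : ∀ S ∈ 𝒮, IsMarkov S) {μ : Measure K}
  [IsProbabilityMeasure μ] (hμ : IsInvariantProb 𝒮 μ)

include h𝒮 hμ

theorem norm_inducedL1_le {S : Op K} (hS : S ∈ 𝒮) (u : Lp ℂ 1 μ) : ‖inducedL1 μ S u‖ ≤ ‖u‖ := by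
  have := hμ.regular
  have hd : DenseRange (ContinuousMap.toLp 1 μ ℂ : C(K, ℂ) →L[ℂ] Lp ℂ 1 μ) :=
    ContinuousMap.toLp_denseRange ℂ μ ℂ ENNReal.one_ne_top
  refine hd.induction_on u (isClosed_le (by fun_prop) (by fun_prop)) fun g => ?_
  rw [inducedL1_toLp h𝒮 hμ hS, norm_toLp_one, norm_toLp_one]
  exact integral_norm_apply_le h𝒮 hμ hS g

/-- The `L¹`-distance between `S |u|` and `|S u|` is the loss of norm from `u` to `S u`. -/
theorem norm_inducedL1_modL1_sub {S : Op K} (hS : S ∈ 𝒮) (u : Lp ℂ 1 μ) :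
    ‖inducedL1 μ S (modL1 u) - modL1 (inducedL1 μ S u)‖ = ‖u‖ - ‖inducedL1 μ S u‖ := by
  have := hμ.regular
  have hd : DenseRange (ContinuousMap.toLp 1 μ ℂ : C(K, ℂ) →L[ℂ] Lp ℂ 1 μ) :=
    ContinuousMap.toLp_denseRange ℂ μ ℂ ENNReal.one_ne_top
  have hc : Continuous (modL1 : Lp ℂ 1 μ → Lp ℂ 1 μ) := continuous_modL1
  refine hd.induction_on u (isClosed_eq (by fun_prop) (by fun_prop)) fun g => ?_
  rw [inducedL1_toLp h𝒮 hμ hS, modL1_toLp, modL1_toLp, inducedL1_toLp h𝒮 hμ hS, ← map_sub,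
    norm_toLp_one, norm_toLp_one, norm_toLp_one]
  -- By density it suffices to treat continuous `g`. There `|S g| ≤ S |g|` pointwise, so the norm of
  -- the difference integrates without cancellation, and invariance turns `∫ S |g|` into `∫ |g|`.
  have h1 : ∀ x, ‖(S (modulus g) - modulus (S g)) x‖ = (S (modulus g) x).re - ‖S g x‖ := by
    intro x
    have h2 : S (modulus g) x = ((S (modulus g) x).re : ℂ) := Complex.eq_re_of_ofReal_le
      ((h𝒮 S hS).positive _ (fun y => by simp [modulus]) x)
    have h3 : (S (modulus g) - modulus (S g)) x
        = (((S (modulus g) x).re - ‖S g x‖ : ℝ) : ℂ) := by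
      rw [ContinuousMap.sub_apply, h2]
      simp [modulus]
    rw [h3, Complex.norm_real, Real.norm_of_nonneg (sub_nonneg.2 ((h𝒮 S hS).norm_apply_le g x))]
  have h4 : ∫ x, (S (modulus g) x).re ∂μ = ∫ x, ‖g x‖ ∂μ := by
    have h5 : ∫ x, (S (modulus g) x).re ∂μ = (∫ x, S (modulus g) x ∂μ).re :=
      integral_re (integrable_continuousMap μ (S (modulus g)))
    have h6 : ∫ x, modulus g x ∂μ = ((∫ x, ‖g x‖ ∂μ : ℝ) : ℂ) := integral_ofReal
    rw [h5, hμ.invariant S hS, h6, Complex.ofReal_re]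
  simp_rw [h1]
  have h7 : Integrable (fun x => (S (modulus g) x).re) μ :=
    (integrable_continuousMap μ (S (modulus g))).re
  rw [integral_sub h7 (integrable_continuousMap μ (S g)).norm, h4]

omit h𝒮 hμ [T2Space K] in
theorem mem_fixL1 {u : Lp ℂ 1 μ} : u ∈ fixL1 𝒮 μ ↔ ∀ S ∈ 𝒮, inducedL1 μ S u = u := by
  simp [fixL1, Submodule.mem_iInf, LinearMap.mem_eqLocus]

/-- A fixed vector loses no norm under `S`, and the loss of norm is exactly the distance between `S
|u|` and `|S u| = |u|`. -/
theorem modL1_mem_fixL1 {u : Lp ℂ 1 μ} (hu : u ∈ fixL1 𝒮 μ) : modL1 u ∈ fixL1 𝒮 μ := by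
  rw [mem_fixL1] at hu ⊢
  intro S hS
  have h := norm_inducedL1_modL1_sub h𝒮 hμ hS u
  rwa [hu S hS, sub_self, norm_eq_zero, sub_eq_zero] at h

theorem toLp_one_mem_fixL1 : (ContinuousMap.toLp 1 μ ℂ (1 : C(K, ℂ)) : Lp ℂ 1 μ) ∈ fixL1 𝒮 μ := by
  rw [mem_fixL1]
  intro S hS
  rw [inducedL1_toLp h𝒮 hμ hS, (h𝒮 S hS).map_one]

omit h𝒮 hμ [T2Space K] in
/-- The `L¹`-norm of `n |u| - f`, corrected by that of `n |u|`, picks out the support of `u` in the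
limit. -/
theorem tendsto_norm_nsmul_modL1_sub (u : Lp ℂ 1 μ) {f : C(K, ℂ)} (hf : ∀ x, 0 ≤ f x) :
    Tendsto (fun n : ℕ => ‖n • modL1 u - ContinuousMap.toLp 1 μ ℂ f‖ - ‖n • modL1 u‖) atTop
      (𝓝 (∫ x, ({x | u x ≠ 0}ᶜ.indicator (fun x => (f x).re) x
        - {x | u x ≠ 0}.indicator (fun x => (f x).re) x) ∂μ)) := by
  have hint : Integrable (fun x => ‖u x‖) μ := (L1.integrable_coeFn u).norm
  have hfint : Integrable (fun x => (f x).re) μ := (integrable_continuousMap μ f).re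
  have h1 : ∀ n : ℕ, ‖n • modL1 u - ContinuousMap.toLp 1 μ ℂ f‖ - ‖n • modL1 u‖ =
      ∫ x, (|n * ‖u x‖ - (f x).re| - n * ‖u x‖) ∂μ := by
    intro n
    rw [L1.norm_eq_integral_norm, L1.norm_eq_integral_norm,
      ← integral_sub (L1.integrable_coeFn _).norm (L1.integrable_coeFn _).norm]
    refine integral_congr_ae ?_
    filter_upwards [Lp.coeFn_sub (n • modL1 u) (ContinuousMap.toLp 1 μ ℂ f),
      Lp.coeFn_smul (n : ℂ) (modL1 u), coeFn_modL1 u,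
      ContinuousMap.coeFn_toLp (p := 1) (𝕜 := ℂ) μ f] with x h2 h3 h4 h5
    rw [Nat.cast_smul_eq_nsmul] at h3
    have h6 : f x = ((f x).re : ℂ) := Complex.eq_re_of_ofReal_le (hf x)
    rw [h2, Pi.sub_apply, h3, Pi.smul_apply, h4, h5, h6]
    have h7 : (n : ℂ) • ((‖u x‖ : ℝ) : ℂ) = ((n * ‖u x‖ : ℝ) : ℂ) := by simp
    rw [h7, ← Complex.ofReal_sub, Complex.norm_real, Complex.norm_real, Real.norm_eq_abs,
      Real.norm_of_nonneg (by positivity), Complex.ofReal_re]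
  simp_rw [h1]
  -- The integrand `|n|u| - f| - n|u|` is bounded by `f`. Where `u = 0` it equals `f`; where `u ≠ 0`
  -- it equals `-f` as soon as `n|u| ≥ f`.
  refine tendsto_integral_of_dominated_convergence (fun x => |(f x).re|) (fun n => ?_) hfint.abs
    (fun n => ae_of_all _ fun x => ?_) (ae_of_all _ fun x => ?_)
  · exact (((hint.const_mul (n : ℝ)).sub hfint).abs.sub (hint.const_mul (n : ℝ))).1
  · have h2 : (0 : ℝ) ≤ n * ‖u x‖ := by positivity
    rw [Real.norm_eq_abs]
    have h3 := abs_abs_sub_abs_le_abs_sub ((n : ℝ) * ‖u x‖ - (f x).re) (n * ‖u x‖)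
    rw [abs_of_nonneg h2] at h3
    refine h3.trans_eq ?_
    rw [sub_sub_cancel_left, abs_neg]
  · have hf0 : 0 ≤ (f x).re := (Complex.nonneg_iff.1 (hf x)).1
    by_cases hx : u x = 0
    · simp [hx, abs_of_nonneg hf0]
    · have hpos : 0 < ‖u x‖ := norm_pos_iff.2 hx
      refine tendsto_const_nhds.congr' ?_
      obtain ⟨N, hN⟩ := exists_nat_ge ((f x).re / ‖u x‖)
      filter_upwards [eventually_ge_atTop N] with n hn
      have h2 : (f x).re ≤ n * ‖u x‖ := by
        rw [← div_le_iff₀ hpos]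
        exact hN.trans (by exact_mod_cast hn)
      rw [abs_of_nonneg (sub_nonneg.2 h2)]
      simp [hx]

omit h𝒮 hμ [T2Space K] [TopologicalSpace K] [CompactSpace K] [BorelSpace K] [IsProbabilityMeasure μ] in
theorem measurableSet_support_L1 (u : Lp ℂ 1 μ) : MeasurableSet {x | u x ≠ 0} :=
  (Lp.stronglyMeasurable u).measurable (measurableSet_singleton 0).compl

/-- The measure `μ`, restricted to the support of a fixed vector, is invariant. -/
theorem setIntegral_support_apply {u : Lp ℂ 1 μ} (hu : u ∈ fixL1 𝒮 μ) {S : Op K} (hS : S ∈ 𝒮)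
    (f : C(K, ℂ)) : ∫ x in {x | u x ≠ 0}, S f x ∂μ = ∫ x in {x | u x ≠ 0}, f x ∂μ := by
  set E := {x | u x ≠ 0} with hE
  have hEm : MeasurableSet E := measurableSet_support_L1 u
  have hSM := h𝒮 S hS
  have hre : ∀ g : C(K, ℂ), Integrable (fun x => (g x).re) μ :=
    fun g => (integrable_continuousMap μ g).re
  have hreint : ∀ g : C(K, ℂ), ∫ x, (S g x).re ∂μ = ∫ x, (g x).re ∂μ := by
    intro g
    have h1 : ∀ g : C(K, ℂ), ∫ x, (g x).re ∂μ = (∫ x, g x ∂μ).re :=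
      fun g => integral_re (integrable_continuousMap μ g)
    rw [h1, h1, hμ.invariant S hS]
  have key : ∀ g : C(K, ℂ), (∀ x, 0 ≤ g x) →
      ∫ x in E, (g x).re ∂μ ≤ ∫ x in E, (S g x).re ∂μ := by
    intro g hg
    have hfix := (mem_fixL1.1 (modL1_mem_fixL1 h𝒮 hμ hu)) S hS
    -- Contractivity applied to `n|u| - g`, with `n|u|` fixed, and then `n → ∞`: passing from `g` to
    -- `S g` does not increase the integral over the complement of `E` minus the integral over `E`.
    -- As the total integral is preserved, the mass on `E` cannot decrease.
    have hle := le_of_tendsto_of_tendsto'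
      (tendsto_norm_nsmul_modL1_sub u (hSM.positive g hg)) (tendsto_norm_nsmul_modL1_sub u hg)
      fun n => by
        have h1 := norm_inducedL1_le h𝒮 hμ hS (n • modL1 u - ContinuousMap.toLp 1 μ ℂ g)
        rw [map_sub, map_nsmul, hfix, inducedL1_toLp h𝒮 hμ hS] at h1
        exact sub_le_sub_right h1 _
    have hsplit : ∀ g : C(K, ℂ), ∫ x, (Eᶜ.indicator (fun x => (g x).re) x
        - E.indicator (fun x => (g x).re) x) ∂μ
        = ∫ x, (g x).re ∂μ - 2 * ∫ x in E, (g x).re ∂μ := by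
      intro g
      rw [integral_sub ((hre g).indicator hEm.compl) ((hre g).indicator hEm),
        integral_indicator hEm, integral_indicator hEm.compl,
        ← integral_add_compl hEm (hre g)]
      ring
    rw [hsplit, hsplit, hreint] at hle
    linarith
  have heq : ∀ g : C(K, ℂ), (∀ x, 0 ≤ g x) →
      ∫ x in E, (S g x).re ∂μ = ∫ x in E, (g x).re ∂μ := by
    intro g hg
    refine le_antisymm ?_ (key g hg)
    -- The reverse inequality comes from applying `key` to `‖g‖ - g ≥ 0`, because `S` fixes
    -- constants.
    have h1 := key (((‖g‖ : ℝ) : ℂ) • 1 - g) fun x => by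
      rw [Complex.nonneg_iff]
      have h2 := (Complex.re_le_norm (g x)).trans (g.norm_coe_le_norm x)
      have h3 := (Complex.nonneg_iff.1 (hg x)).2
      simpa [← h3] using h2
    rw [map_sub, map_smul, hSM.map_one] at h1
    have h4 : ∀ g' : C(K, ℂ), ∫ x in E, (((((‖g‖ : ℝ) : ℂ) • (1 : C(K, ℂ)) - g') x).re) ∂μ
        = (∫ x in E, ‖g‖ ∂μ) - ∫ x in E, (g' x).re ∂μ := by
      intro g'
      rw [← integral_sub (integrable_const _) (hre g').integrableOn]
      simp
    rw [h4, h4] at h1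
    linarith
  have hlin : ∀ g : C(K, ℂ), Integrable (fun x => g x) (μ.restrict E) :=
    fun g => integrable_continuousMap _ g
  let Λ : C(K, ℂ) →ₗ[ℂ] ℂ :=
    { toFun := fun g => ∫ x in E, g x ∂μ
      map_add' := fun f g => integral_add (hlin f) (hlin g)
      map_smul' := fun c f => by simp [integral_const_mul] }
  have hext : Λ.comp S.toLinearMap = Λ := by
    refine linearMap_ext_of_nonneg fun g hg => ?_
    change ∫ x in E, S g x ∂μ = ∫ x in E, g x ∂μ
    have h1 : ∀ g' : C(K, ℂ), (∀ x, 0 ≤ g' x) →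
        ∫ x in E, g' x ∂μ = ((∫ x in E, (g' x).re ∂μ : ℝ) : ℂ) := by
      intro g' hg'
      exact (integral_congr_ae (ae_of_all _ fun x => Complex.eq_re_of_ofReal_le (hg' x))).trans
        integral_ofReal
    rw [h1 _ (hSM.positive g hg), h1 g hg, heq g hg]
  exact LinearMap.congr_fun hext f

end FixedSpace

/-- A point of the plane is determined by its distances to three non-collinear points. This reduces
constancy of a complex fixed vector to constancy of real functions `|u - c|`. -/
theorem eq_of_norm_sub_eq {z w : ℂ} (h0 : ‖z - 0‖ = ‖w - 0‖) (h1 : ‖z - 1‖ = ‖w - 1‖)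
    (hI : ‖z - Complex.I‖ = ‖w - Complex.I‖) : z = w := by
  have h2 : ∀ c : ℂ, ‖z - c‖ = ‖w - c‖ → Complex.normSq (z - c) = Complex.normSq (w - c) :=
    fun c h => by rw [Complex.normSq_eq_norm_sq, Complex.normSq_eq_norm_sq, h]
  have e0 := h2 _ h0
  have e1 := h2 _ h1
  have e2 := h2 _ hI
  simp [Complex.normSq_apply] at e0 e1 e2
  apply Complex.ext <;> linarith

/-! ### Extreme invariant measures are ergodic, and ergodic measures yield primitive ideals. -/

section Ergodic

variable {K : Type*} [TopologicalSpace K] [CompactSpace K] [T2Space K]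
  [MeasurableSpace K] [BorelSpace K]

theorem measure_ext_of_integral_eq {μ ν : Measure K} [μ.Regular] [ν.Regular]
    (h : ∀ f : C(K, ℂ), ∫ x, f x ∂μ = ∫ x, f x ∂ν) : μ = ν := by
  refine Measure.ext_of_integral_eq_on_compactlySupported fun f => ?_
  have h1 := h (ofRealC f.toContinuousMap)
  have h2 : ∀ ρ : Measure K, ∫ x, ofRealC f.toContinuousMap x ∂ρ = ((∫ x, f x ∂ρ : ℝ) : ℂ) :=
    fun ρ => integral_ofReal
  rw [h2, h2] at h1
  exact_mod_cast h1

variable {𝒮 : Subsemigroup (Op K)} {L : Set K} {μ : Measure K} [IsProbabilityMeasure μ]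

omit [T2Space K] [CompactSpace K] [BorelSpace K] [IsProbabilityMeasure μ] in
theorem integral_cond (E : Set K) (f : C(K, ℂ)) :
    ∫ x, f x ∂(ProbabilityTheory.cond μ E) = ((μ.real E)⁻¹ : ℝ) • ∫ x in E, f x ∂μ := by
  rw [ProbabilityTheory.cond, integral_smul_measure, ENNReal.toReal_inv, measureReal_def]

omit [T2Space K] in
/-- Conditioning an invariant measure on an invariant set preserves invariance. -/
theorem cond_mem_invariantStates (hμ : (fun f : C(K, ℂ) => ∫ x, f x ∂μ) ∈ invariantStates 𝒮 L)
    {E : Set K} (hE0 : μ E ≠ 0)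
    (hE : ∀ S ∈ 𝒮, ∀ f : C(K, ℂ), ∫ x in E, S f x ∂μ = ∫ x in E, f x ∂μ) :
    (fun f : C(K, ℂ) => ∫ x, f x ∂(ProbabilityTheory.cond μ E)) ∈ invariantStates 𝒮 L := by
  have := ProbabilityTheory.cond_isProbabilityMeasure hE0
  refine ⟨isState_integral _, fun S hS f => ?_, fun f hf => ?_⟩
  · simp only [integral_cond, hE S hS]
  -- If `f` vanishes on `L`, so does `|f|`; hence `f = 0` almost everywhere for `μ`, and its
  -- integral over any subset is zero.
  · have h1 : ∫ x, modulus f x ∂μ = 0 := hμ.2.2 (modulus f) fun x hx => by simp [modulus, hf x hx]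
    have h2 : ∫ x, modulus f x ∂μ = ((∫ x, ‖f x‖ ∂μ : ℝ) : ℂ) := integral_ofReal
    rw [h2, Complex.ofReal_eq_zero,
      integral_eq_zero_iff_of_nonneg (fun x => norm_nonneg _)
        (integrable_continuousMap μ f).norm] at h1
    simp only [integral_cond]
    rw [setIntegral_eq_zero_of_ae_eq_zero, smul_zero]
    filter_upwards [h1] with x hx _
    simpa using hx

/-- For an extreme invariant measure, invariant sets are trivial. -/
theorem measure_eq_zero_or_of_mem_extremePoints [μ.Regular]
    (hμ : (fun f : C(K, ℂ) => ∫ x, f x ∂μ) ∈ (invariantStates 𝒮 L).extremePoints ℝ)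
    {E : Set K} (hEm : MeasurableSet E)
    (hE : ∀ S ∈ 𝒮, ∀ f : C(K, ℂ), ∫ x in E, S f x ∂μ = ∫ x in E, f x ∂μ) :
    μ E = 0 ∨ μ Eᶜ = 0 := by
  rw [mem_extremePoints_iff_left] at hμ
  by_contra! hne
  have hEc : ∀ S ∈ 𝒮, ∀ f : C(K, ℂ), ∫ x in Eᶜ, S f x ∂μ = ∫ x in Eᶜ, f x ∂μ := by
    intro S hS f
    have h1 := hμ.1.2.1 S hS f
    simp only at h1
    rw [← integral_add_compl hEm (integrable_continuousMap μ (S f)),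
      ← integral_add_compl hEm (integrable_continuousMap μ f), hE S hS] at h1
    exact add_left_cancel h1
  have hpos : ∀ {F : Set K}, μ F ≠ 0 → 0 < μ.real F := fun h =>
    ENNReal.toReal_pos h (measure_ne_top _ _)
  -- `μ` is the convex combination of its conditional measures on `E` and its complement, with
  -- weights `μ E` and `μ Eᶜ`; extremality makes the first one equal to `μ`.
  have heq := hμ.2 _ (cond_mem_invariantStates hμ.1 hne.1 hE) _
    (cond_mem_invariantStates hμ.1 hne.2 hEc)
    ⟨μ.real E, μ.real Eᶜ, hpos hne.1, hpos hne.2, probReal_add_probReal_compl hEm, by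
      ext f
      simp only [Pi.add_apply, Pi.smul_apply, integral_cond]
      rw [smul_inv_smul₀ (hpos hne.1).ne', smul_inv_smul₀ (hpos hne.2).ne',
        integral_add_compl hEm (integrable_continuousMap μ f)]⟩
  have hreg : (ProbabilityTheory.cond μ E).Regular := by
    have : (μ.restrict E).Regular := Measure.Regular.restrict_of_measure_ne_top (measure_ne_top _ _)
    exact Measure.Regular.smul (ENNReal.inv_ne_top.2 hne.1)
  have hcond : ProbabilityTheory.cond μ E = μ :=
    measure_ext_of_integral_eq fun f => congrFun heq f
  refine hne.2 ?_
  rw [← hcond, ProbabilityTheory.cond_apply hEm]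
  simp

/-- Extreme invariant measures are ergodic. -/
theorem isErgodic_of_mem_extremePoints (h𝒮 : ∀ S ∈ 𝒮, IsMarkov S) [μ.Regular]
    (hμ : (fun f : C(K, ℂ) => ∫ x, f x ∂μ) ∈ (invariantStates 𝒮 L).extremePoints ℝ) :
    IsErgodic 𝒮 μ := by
  have hinv : IsInvariantProb 𝒮 μ := ⟨inferInstance, inferInstance, hμ.1.2.1⟩
  refine ⟨hinv, ?_⟩
  set e : Lp ℂ 1 μ := ContinuousMap.toLp 1 μ ℂ (1 : C(K, ℂ)) with he
  have hemem : e ∈ fixL1 𝒮 μ := toLp_one_mem_fixL1 h𝒮 hinv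
  have hecoe : ⇑e =ᵐ[μ] fun _ => (1 : ℂ) :=
    (ContinuousMap.coeFn_toLp (p := 1) (𝕜 := ℂ) μ (1 : C(K, ℂ))).trans (ae_of_all _ fun _ => rfl)
  have hsub : ∀ (u : Lp ℂ 1 μ) (c : ℂ), ⇑(u - c • e) =ᵐ[μ] fun x => u x - c := by
    intro u c
    filter_upwards [Lp.coeFn_sub u (c • e), Lp.coeFn_smul c e, hecoe] with x h1 h2 h3
    rw [h1, Pi.sub_apply, h2, Pi.smul_apply, h3, smul_eq_mul, mul_one]
  have hsubmem : ∀ {u : Lp ℂ 1 μ} (c : ℂ), u ∈ fixL1 𝒮 μ → u - c • e ∈ fixL1 𝒮 μ :=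
    fun c hu => Submodule.sub_mem _ hu (Submodule.smul_mem _ _ hemem)
  -- With `w = |u - c| - t`, the vector `|w| + w` is fixed and is nonzero exactly where `|u - c| >
  -- t`. Each such level set is therefore null or conull, and the rays `(t, ∞)` separate the points
  -- of the line.
  have hconst : ∀ u ∈ fixL1 𝒮 μ, ∀ c : ℂ, ∃ r : ℝ, ∀ᵐ x ∂μ, ‖u x - c‖ = r := by
    intro u hu c
    have hsep : HasCountableSeparatingOn ℝ (· ∈ Set.range Set.Ioi) Set.univ :=
      HasCountableSeparatingOn.range_Ioi
    refine Filter.exists_eventuallyEq_const_of_forall_separating (· ∈ Set.range Set.Ioi) ?_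
    rintro _ ⟨t, rfl⟩
    set v := modL1 (u - c • e)
    set w := v - (t : ℂ) • e
    have hw : w ∈ fixL1 𝒮 μ := hsubmem _ (modL1_mem_fixL1 h𝒮 hinv (hsubmem _ hu))
    have hs : modL1 w + w ∈ fixL1 𝒮 μ :=
      Submodule.add_mem _ (modL1_mem_fixL1 h𝒮 hinv hw) hw
    have hcoe : ∀ᵐ x ∂μ, (modL1 w + w) x ≠ 0 ↔ ‖u x - c‖ ∈ Set.Ioi t := by
      filter_upwards [Lp.coeFn_add (modL1 w) w, coeFn_modL1 w, hsub v t,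
        coeFn_modL1 (u - c • e), hsub u c] with x h1 h2 h3 h4 h5
      rw [h1, Pi.add_apply, h2, h3, h4, h5, ← Complex.ofReal_sub, Complex.norm_real,
        Real.norm_eq_abs, ← Complex.ofReal_add, Ne, Complex.ofReal_eq_zero, Set.mem_Ioi]
      constructor
      · intro h
        by_contra! hle
        exact h (by rw [abs_of_nonpos (by linarith)]; ring)
      · intro h
        rw [abs_of_pos (by linarith)]
        linarith
    rcases measure_eq_zero_or_of_mem_extremePoints hμ (measurableSet_support_L1 (modL1 w + w))
      (fun S hS f => setIntegral_support_apply h𝒮 hinv hs hS f) with h0 | h0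
    · right
      have h0' : ∀ᵐ x ∂μ, x ∉ {x | (modL1 w + w) x ≠ 0} := measure_eq_zero_iff_ae_notMem.1 h0
      filter_upwards [h0', hcoe] with x hx hx' using fun h => hx (hx'.2 h)
    · left
      have h0' : ∀ᵐ x ∂μ, x ∉ {x | (modL1 w + w) x ≠ 0}ᶜ := measure_eq_zero_iff_ae_notMem.1 h0
      filter_upwards [h0', hcoe] with x hx hx' using hx'.1 (not_not.1 hx)
  rw [finrank_eq_one_iff']
  refine ⟨⟨e, hemem⟩, fun h => ?_, fun ⟨u, hu⟩ => ?_⟩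
  · have h1 : ‖e‖ = 1 := by
      rw [he, norm_toLp_one]
      simp
    rw [show e = 0 from congrArg Subtype.val h] at h1
    simp at h1
  · obtain ⟨r0, h0⟩ := hconst u hu 0
    obtain ⟨r1, h1⟩ := hconst u hu 1
    obtain ⟨r2, h2⟩ := hconst u hu Complex.I
    -- The constant is the value `u y` at any point `y` where all three distances take their almost
    -- sure values.
    obtain ⟨y, hy0, hy1, hy2⟩ := (h0.and (h1.and h2)).exists
    refine ⟨u y, Subtype.ext ?_⟩
    change u y • e = u
    refine Lp.ext ?_
    filter_upwards [h0, h1, h2, Lp.coeFn_smul (u y) e, hecoe] with x hx0 hx1 hx2 hx3 hx4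
    rw [hx3, Pi.smul_apply, hx4, smul_eq_mul, mul_one]
    exact eq_of_norm_sub_eq (hy0.trans hx0.symm) (hy1.trans hx1.symm) (hy2.trans hx2.symm)

omit [T2Space K] in
theorem integral_norm_eq_zero_iff (f : C(K, ℂ)) : ∫ x, ‖f x‖ ∂μ = 0 ↔ ∀ᵐ x ∂μ, f x = 0 := by
  rw [integral_eq_zero_iff_of_nonneg (fun x => norm_nonneg _) (integrable_continuousMap μ f).norm]
  constructor <;> intro h <;> filter_upwards [h] with x hx <;> simpa using hx

omit [T2Space K] in
/-- The absolute kernel of an ergodic measure is a primitive ideal. -/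
theorem IsErgodic.exists_primitive (h𝒮 : ∀ S ∈ 𝒮, IsMarkov S) (hμ : IsErgodic 𝒮 μ) :
    ∃ p ∈ primSpectrum 𝒮, (p : Set C(K, ℂ)) = absKernel μ := by
  have hmem : ∀ f : C(K, ℂ), f ∈ absKernel μ ↔ ∀ᵐ x ∂μ, f x = 0 := integral_norm_eq_zero_iff
  let p : Ideal C(K, ℂ) :=
    { carrier := absKernel μ
      add_mem' := fun {f g} hf hg => by
        rw [hmem] at hf hg ⊢
        filter_upwards [hf, hg] with x h1 h2
        simp [h1, h2]
      zero_mem' := by simp [hmem]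
      smul_mem' := fun c f hf => by
        rw [hmem] at hf ⊢
        filter_upwards [hf] with x h1
        simp [h1] }
  refine ⟨p, ⟨⟨?_, ?_, ?_⟩, μ, hμ, rfl⟩, rfl⟩
  · have hp : (p : Set C(K, ℂ)) = {f | ‖(ContinuousMap.toLp 1 μ ℂ f : Lp ℂ 1 μ)‖ = 0} := by
      ext f
      rw [Set.mem_ofPred_eq, norm_toLp_one]
      rfl
    rw [hp]
    exact isClosed_eq (by fun_prop) (by fun_prop)
  · rw [Ne, Ideal.eq_top_iff_one]
    change ¬ (1 : C(K, ℂ)) ∈ absKernel μ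
    simp [hmem, IsProbabilityMeasure.ne_zero μ]
  · obtain ⟨hinv, -⟩ := hμ
    intro S hS f hf
    refine le_antisymm ((integral_norm_apply_le h𝒮 hinv hS f).trans_eq hf) ?_
    exact integral_nonneg fun x => norm_nonneg _

/-- If `I_μ` contains `I_L`, then `μ` is concentrated on `L`. -/
theorem measure_compl_eq_zero [μ.Regular] (hL : IsClosed L)
    (h : (vanishingIdeal L : Set C(K, ℂ)) ⊆ absKernel μ) : μ Lᶜ = 0 := by
  -- Inner regularity reduces the claim to compact sets off `L`; a Urysohn function that is `0` on
  -- `L` and `1` on the compact set lies in `I_L`, hence in `I_μ`.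
  rw [hL.isOpen_compl.measure_eq_iSup_isCompact]
  simp only [ENNReal.iSup_eq_zero]
  intro C hCL hC
  obtain ⟨g, hg0, hg1, -⟩ := exists_continuous_zero_one_of_isClosed hL hC.isClosed
    (Set.disjoint_left.2 fun x hx hx' => hCL hx' hx)
  have h1 : ofRealC g ∈ absKernel μ :=
    h (mem_vanishingIdeal.2 fun x hx => by simp [hg0 hx])
  have h2 := (integral_norm_eq_zero_iff (ofRealC g)).1 h1
  rw [measure_eq_zero_iff_ae_notMem]
  filter_upwards [h2] with x hx hxC
  simp [hg1 hxC] at hx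

end Ergodic

/-! ### Properties passing from `𝒮` to its closed convex hull. -/

section Nets

variable {K : Type*} [TopologicalSpace K] [CompactSpace K]

/-- A closed convex condition on `T f` that holds for `T ∈ 𝒮` holds on the closed convex hull. -/
theorem apply_mem_of_mem_closedConvexHullSOT {𝒮 : Subsemigroup (Op K)} {T : Op K}
    (hT : T ∈ closedConvexHullSOT 𝒮) {f : C(K, ℂ)} {D : Set C(K, ℂ)} (hD : IsClosed D)
    (hDc : Convex ℝ D) (h : ∀ S ∈ 𝒮, S f ∈ D) : T f ∈ D := by
  let ev := PointwiseConvergenceCLM.evalCLM (RingHom.id ℂ) C(K, ℂ) f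
  have hcl : IsClosed (ev ⁻¹' D) := hD.preimage ev.continuous
  have hsub : toSOT '' convexHull ℝ (𝒮 : Set (Op K)) ⊆ ev ⁻¹' D := by
    rintro _ ⟨R, hR, rfl⟩
    have hconv : Convex ℝ {R : Op K | R f ∈ D} := by
      intro R₁ h₁ R₂ h₂ a b ha hb hab
      exact hDc h₁ h₂ ha hb hab
    exact convexHull_min (fun S hS => h S hS) hconv hR
  exact closure_minimal hsub hcl hT

omit [CompactSpace K] in
theorem isClosed_setOf_apply_mem (x : K) {C : Set ℂ} (hC : IsClosed C) :
    IsClosed {g : C(K, ℂ) | g x ∈ C} :=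
  hC.preimage (continuous_eval_const x)

omit [CompactSpace K] in
theorem convex_setOf_apply_mem (x : K) {C : Set ℂ} (hC : Convex ℝ C) :
    Convex ℝ {g : C(K, ℂ) | g x ∈ C} :=
  fun _ h₁ _ h₂ _ _ ha hb hab => hC h₁ h₂ ha hb hab

variable {𝒮 : Subsemigroup (Op K)} (h𝒮 : ∀ S ∈ 𝒮, IsMarkov S) {T : Op K}
  (hT : T ∈ closedConvexHullSOT 𝒮)

include hT

theorem apply_eq_of_mem_closedConvexHullSOT {f : C(K, ℂ)} {x : K} {z : ℂ}
    (h : ∀ S ∈ 𝒮, S f x = z) : T f x = z :=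
  apply_mem_of_mem_closedConvexHullSOT hT (isClosed_setOf_apply_mem x isClosed_singleton)
    (convex_setOf_apply_mem x (convex_singleton z)) h

theorem integral_apply_of_mem_closedConvexHullSOT [MeasurableSpace K] [BorelSpace K]
    {μ : Measure K} (hμ : IsInvariantProb 𝒮 μ) (f : C(K, ℂ)) :
    ∫ x, T f x ∂μ = ∫ x, f x ∂μ := by
  have := hμ.isProbabilityMeasure
  -- Continuity for the norm of `C(K)` makes the prescribed integral a closed condition on `T f`;
  -- the integral factors through `L¹`.
  have hcont : Continuous fun g : C(K, ℂ) => ∫ x, g x ∂μ := by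
    have h1 : (fun g : C(K, ℂ) => ∫ x, g x ∂μ) =
        fun g => ∫ x, (ContinuousMap.toLp 1 μ ℂ g : Lp ℂ 1 μ) x ∂μ := by
      ext g
      exact integral_congr_ae (ContinuousMap.coeFn_toLp (p := 1) (𝕜 := ℂ) μ g).symm
    rw [h1]
    exact continuous_integral.comp (ContinuousMap.toLp 1 μ ℂ).continuous
  refine apply_mem_of_mem_closedConvexHullSOT hT
    (D := {g : C(K, ℂ) | ∫ x, g x ∂μ = ∫ x, f x ∂μ}) (isClosed_eq hcont continuous_const) ?_
    fun S hS => hμ.invariant S hS f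
  intro g₁ h₁ g₂ h₂ a b _ _ hab
  simp only [Set.mem_ofPred_eq] at h₁ h₂ ⊢
  have hadd : ∫ x, (a • g₁ + b • g₂) x ∂μ = ∫ x, a • g₁ x ∂μ + ∫ x, b • g₂ x ∂μ :=
    integral_add ((integrable_continuousMap μ g₁).smul a) ((integrable_continuousMap μ g₂).smul b)
  rw [hadd, integral_smul, integral_smul, h₁, h₂, ← add_smul, hab, one_smul]

include h𝒮

/-- Evaluating operators in the closed convex hull at a point yields states. -/
theorem isState_apply_of_mem_closedConvexHullSOT (x : K) : IsState fun f => T f x where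
  add f g := by simp
  smul c f := by simp
  nonneg f hf := by
    have hIci : IsClosed (Set.Ici (0 : ℂ)) := isClosed_Ici
    exact apply_mem_of_mem_closedConvexHullSOT hT (isClosed_setOf_apply_mem x hIci)
      (convex_setOf_apply_mem x (convex_Ici 0)) fun S hS => (h𝒮 S hS).positive f hf x
  one := apply_eq_of_mem_closedConvexHullSOT hT fun S hS => by simp [(h𝒮 S hS).map_one]

end Nets

/-! ### The radical, invariant states, and convergence of ergodic nets on `L`. -/

section Radical

variable {K : Type*} [TopologicalSpace K] [CompactSpace K] [T2Space K]
  [MeasurableSpace K] [BorelSpace K] {𝒮 : Subsemigroup (Op K)} {L : Set K}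

/-- Every invariant state that vanishes on `I_L` vanishes on the moduli of elements of the
radical of `I_L`. -/
theorem invariantState_modulus_eq_zero (h𝒮 : ∀ S ∈ 𝒮, IsMarkov S) {f : C(K, ℂ)}
    (hf : f ∈ rad 𝒮 (vanishingIdeal L)) {Λ : C(K, ℂ) → ℂ} (hΛ : Λ ∈ invariantStates 𝒮 L) :
    Λ (modulus f) = 0 := by
  refine eq_zero_of_extremePoints (fun Λ hΛ => ?_) hΛ
  obtain ⟨μ, _, _, hμ⟩ := hΛ.1.1.exists_measure
  obtain rfl : Λ = fun f : C(K, ℂ) => ∫ x, f x ∂μ := funext hμ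
  obtain ⟨p, hp, hpμ⟩ := (isErgodic_of_mem_extremePoints h𝒮 hΛ).exists_primitive h𝒮
  have hint : ∀ g : C(K, ℂ), ∫ x, modulus g x ∂μ = ((∫ x, ‖g x‖ ∂μ : ℝ) : ℂ) :=
    fun g => integral_ofReal
  have hLp : (vanishingIdeal L : Set C(K, ℂ)) ⊆ p := by
    intro g hg
    rw [hpμ]
    have h1 : ∫ x, modulus g x ∂μ = 0 := hΛ.1.2.2 (modulus g) fun x hx => by
      simp [modulus, mem_vanishingIdeal.1 hg x hx]
    rw [hint] at h1
    exact_mod_cast h1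
  have hfp : f ∈ absKernel μ := by
    rw [← hpμ]
    exact Set.mem_iInter₂.1 hf p ⟨hp, hLp⟩
  change ∫ x, modulus f x ∂μ = 0
  rw [hint]
  exact_mod_cast hfp

variable {A : Type*} [Preorder A] {T : A → Op K}

omit [MeasurableSpace K] [BorelSpace K] in
/-- A right ergodic net converges to zero uniformly on `L` on the moduli of functions that are
annihilated by the invariant states on `L`. -/
theorem tendsto_norm_restrict_of_invariantStates (h𝒮 : ∀ S ∈ 𝒮, IsMarkov S)
    (hT : IsRightErgodicNet 𝒮 T) [CompactSpace L] (hL : IsSIdeal 𝒮 (vanishingIdeal L))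
    {f : C(K, ℂ)} (hf : ∀ Λ ∈ invariantStates 𝒮 L, Λ f = 0) :
    Tendsto (fun α => ‖(T α f).restrict L‖) atTop (𝓝 0) := by
  rw [Metric.tendsto_nhds]
  by_contra hcon
  push Not at hcon
  obtain ⟨ε, hε, hfreq⟩ := hcon
  -- A point of `L` nearly attaining the norm is needed only for bad indices, where `ε / 2` leaves
  -- room for the supremum; for other indices any point of `K` serves.
  have hpt : ∀ α, ∃ x : K, ε ≤ dist ‖(T α f).restrict L‖ 0 → x ∈ L ∧ ε / 2 ≤ ‖T α f x‖ := by
    intro α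
    by_cases hα : ε ≤ dist ‖(T α f).restrict L‖ 0
    · by_contra! hno
      rw [Real.dist_eq, sub_zero, abs_norm] at hα
      have hle : ‖(T α f).restrict L‖ ≤ ε / 2 :=
        (ContinuousMap.norm_le _ (by positivity)).2 fun y => ((hno y).2 y.2).le
      linarith
    · have hne : Nonempty K := by
        by_contra hemp
        rw [not_nonempty_iff] at hemp
        exact hL.ne_top (Ideal.eq_top_iff_one _ |>.2
          (mem_vanishingIdeal.2 fun x => (IsEmpty.false x).elim))
      exact ⟨hne.some, fun h => absurd h hα⟩
  choose x hx using hpt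
  set bad := {α | ε ≤ dist ‖(T α f).restrict L‖ 0} with hbad
  have hne : (atTop ⊓ 𝓟 bad).NeBot := by
    rw [← frequently_mem_iff_neBot]
    exact hfreq.mono fun α hα => by simpa [hbad] using hα
  -- An ultrafilter finer than `atTop` and containing the bad indices plays the role of a convergent
  -- subnet.
  let U := Ultrafilter.of (atTop ⊓ 𝓟 bad)
  have hU : (U : Filter A) ≤ atTop ⊓ 𝓟 bad := Ultrafilter.of_le _
  have hUtop : (U : Filter A) ≤ atTop := hU.trans inf_le_left
  have hUbad : ∀ᶠ α in (U : Filter A), α ∈ bad := hU (mem_inf_of_right (mem_principal_self _))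
  let ρ : A → C(K, ℂ) → ℂ := fun α g => T α g (x α)
  obtain ⟨Λ, hΛ, hlim⟩ := isCompact_setOf_isState.ultrafilter_le_nhds (U.map ρ) <| by
    rw [le_principal_iff]
    change ∀ᶠ α in (U : Filter A), IsState (ρ α)
    exact Eventually.of_forall fun α =>
      isState_apply_of_mem_closedConvexHullSOT h𝒮 (hT.mem_hull α) (x α)
  have hlim' : Tendsto ρ U (𝓝 Λ) := hlim
  have hev : ∀ g, Tendsto (fun α => T α g (x α)) U (𝓝 (Λ g)) := tendsto_pi_nhds.1 hlim'
  have hmem : Λ ∈ invariantStates 𝒮 L := by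
    refine ⟨hΛ, fun S hS g => ?_, fun g hg => ?_⟩
    -- The points `x α` vary with `α`, so the norm convergence of `T α (g - S g)` is what gives
    -- invariance of the limit.
    · have h1 : Tendsto (fun α => T α (g - S g) (x α)) U (𝓝 0) := by
        refine squeeze_zero_norm (fun α => (T α (g - S g)).norm_coe_le_norm (x α)) ?_
        simpa using ((hT.tendsto S hS g).mono_left hUtop).norm
      have h2 := (hev g).sub (hev (S g))
      simp only [map_sub, ContinuousMap.sub_apply] at h1
      exact (sub_eq_zero.1 (tendsto_nhds_unique h2 h1)).symm
    · refine tendsto_nhds_unique (hev g) (tendsto_const_nhds.congr' ?_)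
      filter_upwards [hUbad] with α hα
      exact (apply_eq_of_mem_closedConvexHullSOT (hT.mem_hull α) fun S hS =>
        mem_vanishingIdeal.1 (hL.invariant S hS g (mem_vanishingIdeal.2 hg)) _ (hx α hα).1).symm
  have hge : ε / 2 ≤ ‖Λ f‖ := by
    refine ge_of_tendsto (hev f).norm ?_
    filter_upwards [hUbad] with α hα using (hx α hα).2
  rw [hf Λ hmem, norm_zero] at hge
  linarith

/-- Weak convergence to zero on `L` of `T_α |f|` forces `f` into the radical of `I_L`. -/
theorem mem_rad_of_tendsto [IsDirectedOrder A] [Nonempty A] (hT : IsRightErgodicNet 𝒮 T)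
    (hL : IsClosed L) [CompactSpace L] {f : C(K, ℂ)}
    (hf : ∀ φ : C(L, ℂ) →L[ℂ] ℂ,
      Tendsto (fun α => φ ((T α (modulus f)).restrict L)) atTop (𝓝 0)) :
    f ∈ rad 𝒮 (vanishingIdeal L) := by
  refine Set.mem_iInter₂.2 fun p ⟨⟨_, μ, ⟨hinv, _⟩, hpμ⟩, hLp⟩ => ?_
  rw [hpμ] at hLp ⊢
  have := hinv.isProbabilityMeasure
  have := hinv.regular
  have hμL : μ Lᶜ = 0 := measure_compl_eq_zero hL hLp
  have hLm : MeasurableSet L := hL.measurableSet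
  let ν : Measure L := μ.comap Subtype.val
  have hν : IsFiniteMeasure ν := ⟨by
    rw [comap_subtype_coe_apply hLm]
    exact measure_lt_top _ _⟩
  let φ : C(L, ℂ) →L[ℂ] ℂ := LinearMap.mkContinuous
    { toFun := fun h => ∫ y, h y ∂ν
      map_add' := fun g h => integral_add (integrable_continuousMap ν g)
        (integrable_continuousMap ν h)
      map_smul' := fun c g => by simp [integral_const_mul] } (ν.real Set.univ) fun h => by
        rw [mul_comm]
        exact norm_integral_le_of_norm_le_const (ae_of_all _ h.norm_coe_le_norm)
  have hφ : ∀ g : C(K, ℂ), φ (g.restrict L) = ∫ x, g x ∂μ := by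
    intro g
    change ∫ y : L, g y ∂ν = _
    rw [integral_subtype_comap hLm (fun x => g x),
      Measure.restrict_eq_self_of_ae_mem (measure_eq_zero_iff_ae_notMem.1 hμL |>.mono
        fun x hx => not_not.1 hx)]
  -- By invariance of `μ` this net is constant with value `∫ |f| dμ`, so its limit zero is that
  -- value.
  have hlim := hf φ
  simp only [hφ, integral_apply_of_mem_closedConvexHullSOT (hT.mem_hull _) hinv] at hlim
  have h0 : ∫ x, modulus f x ∂μ = 0 := tendsto_nhds_unique tendsto_const_nhds hlim
  have h1 : ∫ x, modulus f x ∂μ = ((∫ x, ‖f x‖ ∂μ : ℝ) : ℂ) := integral_ofReal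
  rw [h1] at h0
  change ∫ x, ‖f x‖ ∂μ = 0
  exact_mod_cast h0

end Radical

end MarkovRadical

/-! ### The characterisations of the radical and of radical ideals. -/

theorem theorem4p1 {K : Type*} [TopologicalSpace K] [CompactSpace K] [T2Space K]
    [MeasurableSpace K] [BorelSpace K]
    (𝒮 : Subsemigroup (MarkovRadical.Op K))
    (hMarkov : ∀ S ∈ 𝒮, MarkovRadical.IsMarkov S)
    (hAmenable : MarkovRadical.IsRightAmenable 𝒮)
    {A : Type*} [Preorder A] [IsDirectedOrder A] [Nonempty A]
    (T : A → MarkovRadical.Op K) (hT : MarkovRadical.IsRightErgodicNet 𝒮 T)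
    (L : TopologicalSpace.Closeds K)
    (hL : MarkovRadical.IsSIdeal 𝒮 (MarkovRadical.vanishingIdeal (L : Set K))) :
    MarkovRadical.rad 𝒮 (MarkovRadical.vanishingIdeal (L : Set K)) =
        {f : C(K, ℂ) | ∀ φ : C((L : Set K), ℂ) →L[ℂ] ℂ,
          Tendsto (fun α => φ ((T α (MarkovRadical.modulus f)).restrict (L : Set K)))
            atTop (𝓝 0)} ∧
      MarkovRadical.rad 𝒮 (MarkovRadical.vanishingIdeal (L : Set K)) =
        {f : C(K, ℂ) |
          Tendsto (fun α => ‖(T α (MarkovRadical.modulus f)).restrict (L : Set K)‖)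
            atTop (𝓝 0)} ∧
      (MarkovRadical.IsRadicalSIdeal 𝒮 (MarkovRadical.vanishingIdeal (L : Set K)) ↔
        ∀ f : C(K, ℂ),
          Tendsto (fun α => ‖(T α (MarkovRadical.modulus f)).restrict (L : Set K)‖)
              atTop (𝓝 0) →
            ∀ x ∈ L, f x = 0) := by
  have hweak : ∀ f : C(K, ℂ),
      Tendsto (fun α => ‖(T α (MarkovRadical.modulus f)).restrict (L : Set K)‖) atTop (𝓝 0) →
      ∀ φ : C((L : Set K), ℂ) →L[ℂ] ℂ,
        Tendsto (fun α => φ ((T α (MarkovRadical.modulus f)).restrict (L : Set K)))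
          atTop (𝓝 0) := by
    intro f hf φ
    have h := (φ.continuous.tendsto 0).comp (tendsto_zero_iff_norm_tendsto_zero.2 hf)
    rwa [map_zero] at h
  have hrad : ∀ f ∈ MarkovRadical.rad 𝒮 (MarkovRadical.vanishingIdeal (L : Set K)),
      Tendsto (fun α => ‖(T α (MarkovRadical.modulus f)).restrict (L : Set K)‖) atTop (𝓝 0) :=
    fun f hf => MarkovRadical.tendsto_norm_restrict_of_invariantStates hMarkov hT hL fun Λ hΛ =>
      MarkovRadical.invariantState_modulus_eq_zero hMarkov hf hΛ
  have hback : ∀ f : C(K, ℂ), (∀ φ : C((L : Set K), ℂ) →L[ℂ] ℂ,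
      Tendsto (fun α => φ ((T α (MarkovRadical.modulus f)).restrict (L : Set K)))
        atTop (𝓝 0)) → f ∈ MarkovRadical.rad 𝒮 (MarkovRadical.vanishingIdeal (L : Set K)) :=
    fun f hf => MarkovRadical.mem_rad_of_tendsto hT L.isClosed hf
  refine ⟨Set.Subset.antisymm (fun f hf => hweak f (hrad f hf)) fun f hf => hback f hf,
    Set.Subset.antisymm hrad fun f hf => hback f (hweak f hf), fun h f hf => ?_, fun h => ⟨hL, ?_⟩⟩
  · have hmem := hback f (hweak f hf)
    rw [← h.2] at hmem
    exact MarkovRadical.mem_vanishingIdeal.1 hmem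
  · exact Set.Subset.antisymm (fun f hf => Set.mem_iInter₂.2 fun p hp => hp.2 hf) fun f hf =>
      MarkovRadical.mem_vanishingIdeal.2 (h f (hrad f hf))
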